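/- Let $\mathbf{KHaus}$ be the category of compact Hausdorff spaces and continuous maps, and $\mathbf{Meas}$ the category of measurable spaces and measurable maps. Let $H\colon \mathbf{KHaus}\to\mathbf{Meas}$ be the functor that equips a compact Hausdorff space $X$ with its Baire $\sigma$-algebra (the coarsest one making every continuous $h\colon X\to[0,1]$ measurable) and is the identity on maps. Let $\mathcal G$ be the Giry monad on $\mathbf{Meas}$: $\mathcal GX$ is the set of probability measures on $X$ with the coarsest $\sigma$-algebra making every evaluation $p\mapsto p(A)$, $A\subseteq X$ measurable, measurable. Let $\mathcal R$ be the Radon monad on $\mathbf{KHaus}$: $\mathcal RX$ is the set of Radon probability measures on the Borel sets of $X$, with the coarsest topology making $p\mapsto\int_X h\,dp$ continuous for every continuous $h\colon X\to[0,1]$. On maps, both $\mathcal G$ and $\mathcal R$ act by pushforward. Let $\mathrm{res}\colon H\mathcal R\to\mathcal GH$ be the natural transformation that restricts a Radon measure to the Baire sets. A \emph{probability endofunctor} is a pair $(S,\beta)$ of a functor $S\colon\mathbf{KHaus}\to\mathbf{KHaus}$ and a natural transformation $\beta\colon HS\to\mathcal GH$; a morphism $(S,\beta)\to(S',\beta')$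 is a natural transformation $\lambda\colon S\to S'$ with $\beta'\circ H\lambda=\beta$. Then $\mathrm{res}$ is a natural isomorphism, and $(\mathcal R,\mathrm{res})$ is a terminal object of the full subcategory of the probability endofunctors $(S,\beta)$ for which the component $\beta_{[0,1]}$ is continuous as a map from the space $S[0,1]$ to the set of probability measures on $[0,1]$ with its weak topology (the coarsest topology making $p\mapsto\int h\,dp$ continuous for every continuous $h\colon[0,1]\to[0,1]$). -/

import Mathlib

open CategoryTheory MeasureTheory Set Topology
open scoped ENNReal NNReal

universe u

noncomputable section

/-- A Radon probability measure on a topological space with its Borel sets: `p A` is the supremum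
of `p K` over the compact `K ⊆ A`, for every Borel set `A`. -/
@[ext]
structure RadonProb (X : Type u) [TopologicalSpace X] [MeasurableSpace X] : Type u where
  toMeasure : Measure X
  isProb : IsProbabilityMeasure toMeasure
  innerRegular : toMeasure.InnerRegular

namespace RadonProb

attribute [instance] RadonProb.isProb RadonProb.innerRegular

section Basic

variable {X : Type u} [TopologicalSpace X] [MeasurableSpace X]

/-- The coarsest topology for which `p ↦ ∫ h dp` is continuous for each continuous
`h : X → [0,1]`. -/
instance : TopologicalSpace (RadonProb X) :=
  ⨅ h : C(X, unitInterval),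
    TopologicalSpace.induced (fun p : RadonProb X => ∫ x, (h x : ℝ) ∂p.toMeasure) inferInstance

theorem continuous_eval (h : C(X, unitInterval)) :
    Continuous fun p : RadonProb X => ∫ x, (h x : ℝ) ∂p.toMeasure :=
  continuous_iff_le_induced.2 (iInf_le _ h)

theorem continuous_iff {Y : Type*} [TopologicalSpace Y] {f : Y → RadonProb X} :
    Continuous f ↔
      ∀ h : C(X, unitInterval), Continuous fun y => ∫ x, (h x : ℝ) ∂(f y).toMeasure := by
  rw [continuous_iInf_rng]
  exact forall_congr' fun h => continuous_induced_rng

/-- Spaces of Radon probability measures carry their Borel sets. -/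
instance : MeasurableSpace (RadonProb X) := borel _

instance : BorelSpace (RadonProb X) := ⟨rfl⟩

variable [BorelSpace X]

theorem integrable (p : RadonProb X) (h : C(X, unitInterval)) :
    Integrable (fun x => (h x : ℝ)) p.toMeasure :=
  Integrable.of_bound (continuous_subtype_val.comp h.continuous).measurable.aestronglyMeasurable 1
    (ae_of_all _ fun x => by
      rw [Real.norm_eq_abs, abs_of_nonneg (h x).2.1]; exact (h x).2.2)

theorem ofReal_integral (p : RadonProb X) (h : C(X, unitInterval)) :
    ENNReal.ofReal (∫ x, (h x : ℝ) ∂p.toMeasure) = ∫⁻ x, ENNReal.ofReal (h x) ∂p.toMeasure :=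
  ofReal_integral_eq_lintegral_ofReal (p.integrable h) (ae_of_all _ fun x => (h x).2.1)

theorem integral_mem (p : RadonProb X) (h : C(X, unitInterval)) :
    ∫ x, (h x : ℝ) ∂p.toMeasure ∈ unitInterval := by
  refine ⟨integral_nonneg fun x => (h x).2.1, ?_⟩
  calc ∫ x, (h x : ℝ) ∂p.toMeasure ≤ ∫ _, (1 : ℝ) ∂p.toMeasure :=
        integral_mono (p.integrable h) (integrable_const _) fun x => (h x).2.2
    _ = 1 := by simp

/-- Evaluation at `h`, as a continuous map `RX → [0,1]`. -/
def eval (h : C(X, unitInterval)) : C(RadonProb X, unitInterval) :=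
  ⟨fun p => ⟨∫ x, (h x : ℝ) ∂p.toMeasure, p.integral_mem h⟩,
    (continuous_eval h).subtype_mk _⟩

variable {Y : Type u} [TopologicalSpace Y] [MeasurableSpace Y] [BorelSpace Y]

/-- Pushforward of Radon probability measures along a continuous map. -/
def map (f : C(X, Y)) (p : RadonProb X) : RadonProb Y where
  toMeasure := p.toMeasure.map f
  isProb := Measure.isProbabilityMeasure_map f.continuous.measurable.aemeasurable
  innerRegular := Measure.InnerRegular.map_of_continuous f.continuous

theorem integral_map (f : C(X, Y)) (p : RadonProb X) (h : C(Y, unitInterval)) :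
    ∫ y, (h y : ℝ) ∂(p.map f).toMeasure = ∫ x, (h.comp f x : ℝ) ∂p.toMeasure :=
  MeasureTheory.integral_map f.continuous.measurable.aemeasurable
    (continuous_subtype_val.comp h.continuous).measurable.aestronglyMeasurable

theorem continuous_map (f : C(X, Y)) : Continuous (map f) := by
  rw [continuous_iff]
  intro h
  simp_rw [integral_map]
  exact continuous_eval _

/-- The Dirac measure. -/
def dirac (x : X) : RadonProb X where
  toMeasure := Measure.dirac x
  isProb := inferInstance
  innerRegular := ⟨by
    intro U hU r hr
    by_cases hx : x ∈ U
    · refine ⟨{x}, by simpa using hx, isCompact_singleton, hr.trans_le ?_⟩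
      rw [Measure.dirac_apply' _ hU, indicator_of_mem hx]
      exact (Measure.dirac_apply_of_mem (mem_singleton x)).ge
    · rw [Measure.dirac_apply' _ hU, indicator_of_notMem hx] at hr
      exact absurd hr not_lt_zero⟩

theorem continuous_dirac : Continuous (dirac : X → RadonProb X) := by
  rw [continuous_iff]
  intro h
  have hs : StronglyMeasurable fun x => (h x : ℝ) :=
    (continuous_subtype_val.comp h.continuous).measurable.stronglyMeasurable
  have : (fun y => ∫ x, (h x : ℝ) ∂(dirac y).toMeasure) = fun y => (h y : ℝ) :=
    funext fun y => integral_dirac' _ _ hs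
  rw [this]
  exact continuous_subtype_val.comp h.continuous

theorem integral_dirac (x : X) (h : C(X, unitInterval)) :
    ∫ y, (h y : ℝ) ∂(dirac x).toMeasure = h x :=
  integral_dirac' _ _ h.continuous.subtype_val.measurable.stronglyMeasurable

end Basic

section Compact

theorem exists_affine {X : Type u} [TopologicalSpace X] [CompactSpace X] (f : X → ℝ) (hf : Continuous f) :
    ∃ (h : C(X, unitInterval)) (a b : ℝ), f = fun x => a * (h x : ℝ) + b := by
  obtain ⟨c, hc⟩ := isCompact_univ.exists_bound_of_continuousOn hf.continuousOn
  have hc' : ∀ x, |f x| ≤ |c| + 1 := fun x =>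
    (hc x trivial).trans ((le_abs_self c).trans (by linarith))
  have h0 : 0 < |c| + 1 := by positivity
  refine ⟨⟨fun x => ⟨(f x + (|c| + 1)) / (2 * (|c| + 1)), ?_, ?_⟩, ?_⟩, 2 * (|c| + 1), -(|c| + 1), ?_⟩
  · have := abs_le.1 (hc' x)
    exact div_nonneg (by linarith) (by linarith)
  · have := abs_le.1 (hc' x)
    rw [div_le_one (by linarith)]
    linarith
  · exact Continuous.subtype_mk (by fun_prop) _
  · funext x
    simp only [ContinuousMap.coe_mk]
    field_simp
    ring

theorem continuous_integral {X : Type u} [TopologicalSpace X] [CompactSpace X] [MeasurableSpace X]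
    [BorelSpace X] (f : X → ℝ) (hf : Continuous f) :
    Continuous fun p : RadonProb X => ∫ x, f x ∂p.toMeasure := by
  obtain ⟨h, a, b, rfl⟩ := exists_affine f hf
  have : (fun p : RadonProb X => ∫ x, (a * (h x : ℝ) + b) ∂p.toMeasure) =
      fun p => a * (∫ x, (h x : ℝ) ∂p.toMeasure) + b := by
    funext p
    rw [integral_add ((p.integrable h).const_mul a) (integrable_const b), integral_const_mul]
    simp
  rw [this]
  exact ((continuous_eval h).const_mul a).add continuous_const

variable {X : Type u} [TopologicalSpace X] [CompactSpace X] [T2Space X] [MeasurableSpace X]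
  [BorelSpace X]

theorem ext_of_integral {p q : RadonProb X}
    (hpq : ∀ h : C(X, unitInterval), ∫ x, (h x : ℝ) ∂p.toMeasure = ∫ x, (h x : ℝ) ∂q.toMeasure) :
    p = q := by
  refine RadonProb.ext (Measure.ext_of_integral_eq_on_compactlySupported fun f => ?_)
  obtain ⟨h, a, b, hf⟩ := exists_affine f f.continuous
  rw [hf, integral_add ((p.integrable h).const_mul a) (integrable_const b),
    integral_add ((q.integrable h).const_mul a) (integrable_const b), integral_const_mul,
    integral_const_mul, hpq h]
  simp

instance : T2Space (RadonProb X) := by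
  have hinj : Function.Injective
      fun (p : RadonProb X) (h : C(X, unitInterval)) => ∫ x, (h x : ℝ) ∂p.toMeasure :=
    fun p q hpq => ext_of_integral fun h => congrFun hpq h
  exact T2Space.of_injective_continuous hinj (continuous_pi continuous_eval)

theorem exists_eq_integral (μ : Measure X) [IsProbabilityMeasure μ] :
    ∃ p : RadonProb X, ∀ f : X → ℝ, Continuous f → ∫ x, f x ∂p.toMeasure = ∫ x, f x ∂μ := by
  obtain ⟨ν, hν, hν', hint⟩ := μ.exists_regular_eq_of_compactSpace
  have key : ∀ f : X → ℝ, Continuous f → ∫ x, f x ∂ν = ∫ x, f x ∂μ := fun f hf =>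
    (hint (BoundedContinuousFunction.mkOfCompact ⟨f, hf⟩)).symm
  have hν1 : IsProbabilityMeasure ν := by
    have := key (fun _ => 1) continuous_const
    rw [isProbabilityMeasure_iff_real]
    simpa using this
  exact ⟨⟨ν, hν1, inferInstance⟩, key⟩

instance : CompactSpace (RadonProb X) := by
  choose F hF using fun μ : ProbabilityMeasure X => exists_eq_integral (μ : Measure X)
  have hc : Continuous F := by
    rw [continuous_iff]
    intro h
    have hh : Continuous fun x => (h x : ℝ) := continuous_subtype_val.comp h.continuous
    simp_rw [fun μ => hF μ _ hh]
    exact ProbabilityMeasure.continuous_integral_boundedContinuousFunction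
      (BoundedContinuousFunction.mkOfCompact ⟨_, hh⟩)
  have hs : Function.Surjective F := fun p => ⟨⟨p.toMeasure, p.isProb⟩, ext_of_integral fun h =>
    hF ⟨p.toMeasure, p.isProb⟩ _ (continuous_subtype_val.comp h.continuous)⟩
  exact hs.compactSpace hc

theorem measure_isOpen (p : RadonProb X) {U : Set X} (hU : IsOpen U) :
    p.toMeasure U = ⨆ (h : C(X, unitInterval)) (_ : ∀ x ∉ U, h x = 0),
      ENNReal.ofReal (∫ x, (h x : ℝ) ∂p.toMeasure) := by
  rw [hU.measure_eq_biSup_integral_continuous p.toMeasure]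
  apply le_antisymm
  · refine iSup_le fun f => iSup_le fun hf => iSup_le fun h0 => iSup_le fun hf0 => iSup_le fun hf1 => ?_
    exact le_iSup₂_of_le (f := fun (h : C(X, unitInterval)) (_ : ∀ x ∉ U, h x = 0) =>
      ENNReal.ofReal (∫ x, (h x : ℝ) ∂p.toMeasure)) ⟨fun x => ⟨f x, hf0 x, hf1 x⟩, hf.subtype_mk _⟩
      (fun x hx => Subtype.ext (h0 hx)) le_rfl
  · refine iSup₂_le fun h hh => ?_
    refine le_iSup_of_le (fun x => (h x : ℝ)) (le_iSup_of_le (continuous_subtype_val.comp h.continuous)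
      (le_iSup_of_le ?_ (le_iSup_of_le ?_ (le_iSup_of_le ?_ le_rfl))))
    · intro x hx
      simp [hh x hx]
    · exact fun x => (h x).2.1
    · exact fun x => (h x).2.2

theorem measurable_toMeasure : Measurable (RadonProb.toMeasure : RadonProb X → Measure X) := by
  refine Measurable.measure_of_isPiSystem_of_isProbabilityMeasure
    BorelSpace.measurable_eq isPiSystem_isOpen fun U hU => ?_
  simp_rw [fun p : RadonProb X => p.measure_isOpen hU]
  exact (lowerSemicontinuous_iSup fun h => lowerSemicontinuous_iSup fun _ =>
    (ENNReal.continuous_ofReal.comp (continuous_eval h)).lowerSemicontinuous).measurable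

theorem lintegral_bind (P : RadonProb (RadonProb X)) (h : C(X, unitInterval)) :
    ∫⁻ x, ENNReal.ofReal (h x) ∂(P.toMeasure.bind toMeasure) =
      ∫⁻ p, ENNReal.ofReal (eval h p) ∂P.toMeasure := by
  rw [Measure.lintegral_bind measurable_toMeasure.aemeasurable
    (h.continuous.subtype_val.measurable.ennreal_ofReal).aemeasurable]
  exact lintegral_congr fun p => (p.ofReal_integral h).symm

theorem lintegral_le_of_directed (P : RadonProb X) {ι : Type*} [Nonempty ι] (φ : X → ℝ≥0)
    (F : ι → X → ℝ≥0) (hF : ∀ i, Continuous (F i)) (hdir : Directed (· ≤ ·) F)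
    (hφ1 : ∀ x, φ x ≤ 1) (hφ : ∀ x, ∀ t < φ x, ∃ i, t < F i x) {ε : ℝ≥0} (hε : 0 < ε) :
    ∃ i, ∫⁻ x, φ x ∂P.toMeasure ≤ ∫⁻ x, F i x ∂P.toMeasure + ε + ε := by
  obtain ⟨g, hgφ, hg, hint⟩ := exists_upperSemicontinuous_le_lintegral_le (μ := P.toMeasure) φ
    (ne_top_of_le_ne_top ENNReal.one_ne_top ((lintegral_mono fun x => by
      exact ENNReal.coe_le_one_iff.2 (hφ1 x) : _ ≤ ∫⁻ _, 1 ∂P.toMeasure).trans (by simp)))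
    (ε := ε) (by exact_mod_cast hε.ne')
  have hopen : ∀ i, IsOpen {x | g x < F i x + ε} := fun i => by
    rw [isOpen_iff_mem_nhds]
    intro x hx
    obtain ⟨c, hc1, hc2⟩ := exists_between (show g x < F i x + ε from hx)
    have h2 : ∀ᶠ y in 𝓝 x, c < F i y + ε :=
      ((hF i).add continuous_const).continuousAt.eventually (lt_mem_nhds hc2)
    filter_upwards [hg x c hc1, h2] with y hy1 hy2 using hy1.trans hy2
  obtain ⟨i, hi⟩ := isCompact_univ.elim_directed_cover _ hopen (by
    intro x _
    rw [mem_iUnion]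
    rcases le_or_gt (g x) (ε / 2) with h | h
    · exact ⟨Classical.arbitrary ι, (h.trans_lt (NNReal.half_lt_self hε.ne')).trans_le
        le_add_self⟩
    · have hlt : g x - ε / 2 < φ x :=
        (tsub_lt_self (lt_of_le_of_lt zero_le h) (half_pos hε)).trans_le (hgφ x)
      obtain ⟨i, hi⟩ := hφ x _ hlt
      refine ⟨i, ?_⟩
      calc g x ≤ (g x - ε / 2) + ε / 2 := le_tsub_add
        _ < F i x + ε := add_lt_add hi (NNReal.half_lt_self hε.ne'))
    (fun i j => by
      obtain ⟨k, hik, hjk⟩ := hdir i j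
      exact ⟨k, fun x (hx : g x < F i x + ε) => hx.trans_le (add_le_add_left (hik x) ε),
        fun x (hx : g x < F j x + ε) => hx.trans_le (add_le_add_left (hjk x) ε)⟩)
  refine ⟨i, hint.trans (add_le_add_left ?_ _)⟩
  calc ∫⁻ x, g x ∂P.toMeasure ≤ ∫⁻ x, (F i x + ε : ℝ≥0∞) ∂P.toMeasure :=
        lintegral_mono fun x => by
          have hx : g x < F i x + ε := hi (mem_univ x)
          rw [← ENNReal.coe_add]
          exact ENNReal.coe_le_coe.2 hx.le
    _ = ∫⁻ x, F i x ∂P.toMeasure + ε := by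
        rw [lintegral_add_right _ measurable_const]
        simp


theorem bind_isOpen_le (P : RadonProb (RadonProb X)) (q : RadonProb X)
    (hq : ∀ h : C(X, unitInterval), ∫ x, (h x : ℝ) ∂q.toMeasure =
      ∫ p, (eval h p : ℝ) ∂P.toMeasure) {U : Set X} (hU : IsOpen U) :
    P.toMeasure.bind toMeasure U = q.toMeasure U := by
  rw [Measure.bind_apply hU.measurableSet measurable_toMeasure.aemeasurable]
  have hval : ∀ h : C(X, unitInterval), ENNReal.ofReal (∫ x, (h x : ℝ) ∂q.toMeasure) =
      ∫⁻ p, ENNReal.ofReal (∫ x, (h x : ℝ) ∂p.toMeasure) ∂P.toMeasure := fun h => by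
    rw [hq h]
    exact P.ofReal_integral (eval h)
  apply le_antisymm
  · let ι : Type u := {h : C(X, unitInterval) // ∀ x ∉ U, h x = 0}
    let F : {h : C(X, unitInterval) // ∀ x ∉ U, h x = 0} → RadonProb X → ℝ≥0 := fun h p => Real.toNNReal (∫ x, (h.val x : ℝ) ∂p.toMeasure)
    have : Nonempty {h : C(X, unitInterval) // ∀ x ∉ U, h x = 0} := ⟨⟨⟨fun _ => 0, continuous_const⟩, fun _ _ => rfl⟩⟩
    have hφ : ∀ p : RadonProb X, ((p.toMeasure U).toNNReal : ℝ≥0∞) = p.toMeasure U :=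
      fun p => ENNReal.coe_toNNReal (measure_ne_top _ _)
    refine ENNReal.le_of_forall_pos_le_add fun ε hε _ => ?_
    obtain ⟨h, hh⟩ := P.lintegral_le_of_directed (fun p => (p.toMeasure U).toNNReal) F
      (fun h => continuous_real_toNNReal.comp (continuous_eval h.val)) (fun h k => by
        refine ⟨⟨⟨fun x => max (h.1 x) (k.1 x), by fun_prop⟩, fun x hx => ?_⟩,
          fun p => Real.toNNReal_le_toNNReal ?_, fun p => Real.toNNReal_le_toNNReal ?_⟩
        · simp [h.2 x hx, k.2 x hx]
        · exact integral_mono (p.integrable _) (p.integrable _) fun x => le_max_left (h.1 x) (k.1 x)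
        · exact integral_mono (p.integrable _) (p.integrable _) fun x => le_max_right (h.1 x) (k.1 x))
      (fun p => by rw [← ENNReal.coe_le_one_iff, hφ]; exact prob_le_one)
      (fun p t ht => by
        rw [← ENNReal.coe_lt_coe, hφ, p.measure_isOpen hU] at ht
        simp only [lt_iSup_iff] at ht
        obtain ⟨h, h0, hlt⟩ := ht
        exact ⟨⟨h, h0⟩, ENNReal.coe_lt_coe.1 hlt⟩) (half_pos hε)
    simp_rw [hφ] at hh
    rw [add_assoc, ← ENNReal.coe_add, add_halves] at hh
    refine hh.trans (add_le_add_left ?_ _)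
    rw [q.measure_isOpen hU]
    exact le_iSup₂_of_le h.val h.property (hval h.val).ge
  · rw [q.measure_isOpen hU]
    refine iSup₂_le fun h h0 => ?_
    rw [hval h]
    refine lintegral_mono fun p => ?_
    rw [p.measure_isOpen hU]
    exact le_iSup₂_of_le h h0 le_rfl

theorem exists_bind_eq (P : RadonProb (RadonProb X)) :
    ∃ q : RadonProb X, P.toMeasure.bind toMeasure = q.toMeasure ∧
      ∀ h : C(X, unitInterval), ∫ x, (h x : ℝ) ∂q.toMeasure = ∫ p, (eval h p : ℝ) ∂P.toMeasure := by
  have hprob : IsProbabilityMeasure (P.toMeasure.bind toMeasure) := ⟨by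
    rw [Measure.bind_apply MeasurableSet.univ measurable_toMeasure.aemeasurable]
    simp⟩
  obtain ⟨q, hq⟩ := exists_eq_integral (P.toMeasure.bind toMeasure)
  have hq' : ∀ h : C(X, unitInterval),
      ∫ x, (h x : ℝ) ∂q.toMeasure = ∫ p, (eval h p : ℝ) ∂P.toMeasure := fun h => by
    rw [hq _ h.continuous.subtype_val, integral_eq_lintegral_of_nonneg_ae
      (ae_of_all _ fun x => (h x).2.1) h.continuous.subtype_val.measurable.aestronglyMeasurable,
      lintegral_bind, ← P.ofReal_integral, ENNReal.toReal_ofReal (P.integral_mem _).1]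
  refine ⟨q, ?_, hq'⟩
  exact ext_of_generate_finite _ BorelSpace.measurable_eq isPiSystem_isOpen
    (fun U hU => bind_isOpen_le P q hq' hU) (by simp)

/-- The average of a Radon probability measure on `RX`: `A ↦ ∫ p(A) dP(p)`. -/
def join (P : RadonProb (RadonProb X)) : RadonProb X where
  toMeasure := P.toMeasure.bind toMeasure
  isProb := by
    obtain ⟨q, hq, -⟩ := exists_bind_eq P
    rw [hq]
    infer_instance
  innerRegular := by
    obtain ⟨q, hq, -⟩ := exists_bind_eq P
    rw [hq]
    infer_instance

theorem join_apply (P : RadonProb (RadonProb X)) {A : Set X} (hA : MeasurableSet A) :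
    P.join.toMeasure A = ∫⁻ p, p.toMeasure A ∂P.toMeasure :=
  Measure.bind_apply hA measurable_toMeasure.aemeasurable

theorem integral_join (P : RadonProb (RadonProb X)) (h : C(X, unitInterval)) :
    ∫ x, (h x : ℝ) ∂P.join.toMeasure = ∫ p, (eval h p : ℝ) ∂P.toMeasure := by
  obtain ⟨q, hq, hint⟩ := exists_bind_eq P
  rw [← hint h]
  exact congrArg (fun μ : Measure X => ∫ x, (h x : ℝ) ∂μ) hq

theorem continuous_join : Continuous (join : RadonProb (RadonProb X) → RadonProb X) := by
  rw [continuous_iff]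
  intro h
  simp_rw [integral_join]
  exact continuous_eval (eval h)

end Compact
end RadonProb

section RadonMonad

/-- A compact Hausdorff space with its Borel sets. -/
abbrev borelOn (X : CompHaus.{u}) : MeasurableSpace X := borel X

attribute [local instance] borelOn

theorem borelSpace_borelOn (X : CompHaus.{u}) : BorelSpace X := ⟨rfl⟩

attribute [local instance] borelSpace_borelOn

/-- The underlying endofunctor of the Radon monad: Radon probability measures, with pushforward. -/
def radonFunctor : CompHaus.{u} ⥤ CompHaus.{u} where
  obj X :=
    CompHaus.of (RadonProb X)
  map {X Y} f :=
    CompHausLike.ofHom _ ⟨RadonProb.map (ConcreteCategory.hom f), RadonProb.continuous_map _⟩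
  map_id X := by
    refine ConcreteCategory.hom_ext _ _ fun (p : RadonProb X) => ?_
    exact RadonProb.ext Measure.map_id
  map_comp {X Y Z} f g := by
    refine ConcreteCategory.hom_ext _ _ fun (p : RadonProb X) => ?_
    exact RadonProb.ext (Measure.map_map (ConcreteCategory.hom g).continuous.measurable
      (ConcreteCategory.hom f).continuous.measurable).symm

/-- The Radon monad: Dirac measures as unit, averaging as multiplication. -/
def radonMonad : CategoryTheory.Monad CompHaus.{u} where
  toFunctor := radonFunctor
  η :=
    { app := fun X =>
        CompHausLike.ofHom _ ⟨RadonProb.dirac, RadonProb.continuous_dirac⟩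
      naturality := fun X Y f => by
        refine ConcreteCategory.hom_ext _ _ fun (x : X) => ?_
        exact RadonProb.ext
          (Measure.map_dirac' (ConcreteCategory.hom f).continuous.measurable x).symm }
  μ :=
    { app := fun X =>
        CompHausLike.ofHom _ ⟨RadonProb.join, RadonProb.continuous_join⟩
      naturality := fun X Y f => by
        refine ConcreteCategory.hom_ext _ _ fun (P : RadonProb (RadonProb X)) => ?_
        let g : C(X, Y) := ConcreteCategory.hom f
        change (P.map ⟨RadonProb.map g, RadonProb.continuous_map g⟩).join = P.join.map g
        refine RadonProb.ext_of_integral fun h => ?_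
        rw [RadonProb.integral_join, RadonProb.integral_map, RadonProb.integral_map,
          RadonProb.integral_join]
        refine integral_congr_ae (ae_of_all _ fun p => ?_)
        exact RadonProb.integral_map g p h }
  assoc X := by
    refine ConcreteCategory.hom_ext _ _ fun (P : RadonProb (RadonProb (RadonProb X))) => ?_
    change (P.map ⟨RadonProb.join, RadonProb.continuous_join⟩).join = P.join.join
    refine RadonProb.ext_of_integral fun h => ?_
    rw [RadonProb.integral_join, RadonProb.integral_map, RadonProb.integral_join,
      RadonProb.integral_join]
    refine integral_congr_ae (ae_of_all _ fun p => ?_)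
    exact RadonProb.integral_join p h
  left_unit X := by
    refine ConcreteCategory.hom_ext _ _ fun (p : RadonProb X) => ?_
    change (RadonProb.dirac p).join = p
    refine RadonProb.ext_of_integral fun h => ?_
    rw [RadonProb.integral_join, RadonProb.integral_dirac]
    rfl
  right_unit X := by
    refine ConcreteCategory.hom_ext _ _ fun (p : RadonProb X) => ?_
    change (p.map ⟨RadonProb.dirac, RadonProb.continuous_dirac⟩).join = p
    refine RadonProb.ext_of_integral fun h => ?_
    rw [RadonProb.integral_join, RadonProb.integral_map]
    refine integral_congr_ae (ae_of_all _ fun x => ?_)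
    exact RadonProb.integral_dirac x h

end RadonMonad

theorem measurable_giryInclusion {X : Type u} [MeasurableSpace X] :
    Measurable (ProbabilityMeasure.toMeasure : ProbabilityMeasure X → Measure X) :=
  measurable_subtype_coe

/-- The underlying endofunctor of the Giry monad: probability measures, with the coarsest
σ-algebra making each evaluation `p ↦ p A` measurable, and with pushforward. -/
def giryFunctor : MeasCat.{u} ⥤ MeasCat.{u} where
  obj X := MeasCat.of (ProbabilityMeasure X)
  map f := ⟨fun p : ProbabilityMeasure _ => p.map f.2.aemeasurable,
    ((Measure.measurable_map f.1 f.2).comp measurable_giryInclusion).subtype_mk⟩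
  map_id _ := Subtype.ext <| funext fun _ => Subtype.ext Measure.map_id
  map_comp f g := Subtype.ext <| funext fun _ =>
    Subtype.ext (Measure.map_map g.2 f.2).symm

/-- The Dirac measure. -/
def giryDirac {X : Type u} [MeasurableSpace X] (x : X) : ProbabilityMeasure X :=
  ⟨Measure.dirac x, inferInstance⟩

theorem measurable_giryDirac {X : Type u} [MeasurableSpace X] :
    Measurable (giryDirac : X → ProbabilityMeasure X) :=
  Measure.measurable_dirac.subtype_mk

/-- The average of a probability measure on probability measures: `A ↦ ∫ p(A) dP(p)`. -/
def giryJoin {X : Type u} [MeasurableSpace X] (P : ProbabilityMeasure (ProbabilityMeasure X)) :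
    ProbabilityMeasure X :=
  ⟨(P : Measure (ProbabilityMeasure X)).bind ProbabilityMeasure.toMeasure, ⟨by
    rw [Measure.bind_apply MeasurableSet.univ measurable_giryInclusion.aemeasurable]
    simp⟩⟩

theorem measurable_giryJoin {X : Type u} [MeasurableSpace X] :
    Measurable (giryJoin : ProbabilityMeasure (ProbabilityMeasure X) → ProbabilityMeasure X) :=
  ((Measure.measurable_bind' measurable_giryInclusion).comp measurable_giryInclusion).subtype_mk

/-- The Giry monad: Dirac measures as unit, averaging as multiplication. -/
def giryMonad : CategoryTheory.Monad MeasCat.{u} where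
  toFunctor := giryFunctor
  η :=
    { app := fun X => ⟨giryDirac (X := X), measurable_giryDirac⟩
      naturality := fun X Y f => Subtype.ext <| funext fun x => Subtype.ext
        (Measure.map_dirac' f.2 x).symm }
  μ :=
    { app := fun X => ⟨giryJoin (X := X), measurable_giryJoin⟩
      naturality := fun X Y f => Subtype.ext <| funext fun P : ProbabilityMeasure (ProbabilityMeasure X) => Subtype.ext <| by
        have hf : Measurable fun p : ProbabilityMeasure X => p.map f.2.aemeasurable :=
          (giryFunctor.map f).2
        change ((P : Measure (ProbabilityMeasure X)).map
          fun p : ProbabilityMeasure X => p.map f.2.aemeasurable).bind ProbabilityMeasure.toMeasure =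
          ((P : Measure (ProbabilityMeasure X)).bind ProbabilityMeasure.toMeasure).map f.1
        ext A hA
        rw [Measure.bind_apply hA measurable_giryInclusion.aemeasurable,
          lintegral_map (f := fun p : ProbabilityMeasure Y => (p : Measure Y) A)
            ((Measure.measurable_coe hA).comp measurable_giryInclusion) hf,
          Measure.map_apply f.2 hA, Measure.bind_apply (f.2 hA) measurable_giryInclusion.aemeasurable]
        exact lintegral_congr fun p => Measure.map_apply f.2 hA }
  assoc X := Subtype.ext <| funext
      fun P : ProbabilityMeasure (ProbabilityMeasure (ProbabilityMeasure X)) => Subtype.ext <| by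
    change ((P : Measure (ProbabilityMeasure (ProbabilityMeasure X))).map giryJoin).bind ProbabilityMeasure.toMeasure =
      ((P : Measure (ProbabilityMeasure (ProbabilityMeasure X))).bind ProbabilityMeasure.toMeasure).bind ProbabilityMeasure.toMeasure
    rw [Measure.bind_bind measurable_giryInclusion.aemeasurable measurable_giryInclusion.aemeasurable]
    ext A hA
    rw [Measure.bind_apply hA measurable_giryInclusion.aemeasurable,
      lintegral_map (f := fun p : ProbabilityMeasure X => (p : Measure X) A)
        ((Measure.measurable_coe hA).comp measurable_giryInclusion) measurable_giryJoin,
      Measure.bind_apply (f := fun Q : ProbabilityMeasure (ProbabilityMeasure X) =>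
        (Q : Measure (ProbabilityMeasure X)).bind ProbabilityMeasure.toMeasure) hA
        ((Measure.measurable_bind' measurable_giryInclusion).comp
          measurable_giryInclusion).aemeasurable]
    rfl
  left_unit X := Subtype.ext <| funext fun p : ProbabilityMeasure X => Subtype.ext <|
    Measure.dirac_bind measurable_giryInclusion p
  right_unit X := Subtype.ext <| funext fun p : ProbabilityMeasure X => Subtype.ext <| by
    change ((p : Measure X).map giryDirac).bind ProbabilityMeasure.toMeasure = p
    unfold Measure.bind
    rw [Measure.map_map measurable_giryInclusion measurable_giryDirac]
    exact Measure.join_map_dirac _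

/-- The Baire σ-algebra of a topological space: the coarsest σ-algebra making each continuous
`h : X → [0,1]` measurable, where `[0,1]` has its Borel sets. -/
abbrev baireSpace (X : Type u) [TopologicalSpace X] : MeasurableSpace X :=
  ⨆ h : C(X, unitInterval), MeasurableSpace.comap h (borel unitInterval)

section Baire

variable {X : Type u} [TopologicalSpace X]

theorem measurable_baire (h : C(X, unitInterval)) :
    @Measurable X unitInterval (baireSpace X) (borel unitInterval) h :=
  measurable_iff_comap_le.2 (le_iSup (fun h : C(X, unitInterval) => MeasurableSpace.comap h
    (borel unitInterval)) h)

theorem measurable_baire_coe (h : C(X, unitInterval)) :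
    Measurable[baireSpace X] fun x => (h x : ℝ) := by
  have : borel unitInterval = Subtype.instMeasurableSpace := BorelSpace.measurable_eq.symm
  exact measurable_subtype_coe.comp (this ▸ measurable_baire h)

theorem baireSpace_le_borel : baireSpace X ≤ borel X :=
  iSup_le fun h => h.continuous.borel_measurable.comap_le

theorem measurable_baire_map {Y : Type u} [TopologicalSpace Y] (f : C(X, Y)) :
    @Measurable X Y (baireSpace X) (baireSpace Y) f := by
  rw [measurable_iff_comap_le, baireSpace, MeasurableSpace.comap_iSup]
  refine iSup_le fun h => ?_
  rw [MeasurableSpace.comap_comp]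
  exact (measurable_baire (h.comp f)).comap_le

theorem baireSpace_eq_generateFrom : baireSpace X =
    MeasurableSpace.generateFrom {U | ∃ h : C(X, unitInterval), U = {x | h x ≠ 0}} := by
  apply le_antisymm
  · refine iSup_le fun h => ?_
    rw [borel_eq_generateFrom_Ioi, MeasurableSpace.comap_generateFrom]
    refine MeasurableSpace.generateFrom_mono ?_
    rintro _ ⟨_, ⟨a, rfl⟩, rfl⟩
    refine ⟨⟨fun x => ⟨max ((h x : ℝ) - a) 0, le_max_right _ _, ?_⟩, ?_⟩, ?_⟩
    · exact max_le (by linarith [(h x).2.2, a.2.1]) zero_le_one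
    · exact Continuous.subtype_mk (by fun_prop) _
    · ext x
      simp only [mem_preimage, mem_Ioi, ContinuousMap.coe_mk, mem_ofPred_eq, ne_eq, Subtype.ext_iff,
        Icc.coe_zero, max_eq_right_iff, not_le, sub_pos, Subtype.coe_lt_coe]
  · refine MeasurableSpace.generateFrom_le ?_
    rintro _ ⟨h, rfl⟩
    have h0 : IsOpen ({0}ᶜ : Set unitInterval) := isClosed_singleton.isOpen_compl
    exact measurable_baire h (MeasurableSpace.measurableSet_generateFrom h0)

theorem isPiSystem_cozero :
    IsPiSystem {U : Set X | ∃ h : C(X, unitInterval), U = {x | h x ≠ 0}} := by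
  rintro _ ⟨h, rfl⟩ _ ⟨k, rfl⟩ _
  refine ⟨⟨fun x => h x * k x, by fun_prop⟩, ?_⟩
  ext x
  simp

/-- Restriction of a Borel probability measure to the Baire sets. -/
def RadonProb.toBaire (p : @RadonProb X _ (borel X)) : @ProbabilityMeasure X (baireSpace X) :=
  letI : MeasurableSpace X := borel X
  ⟨p.toMeasure.trim baireSpace_le_borel, ⟨by
    rw [trim_measurableSet_eq baireSpace_le_borel (@MeasurableSet.univ X (baireSpace X))]
    exact measure_univ⟩⟩

theorem RadonProb.toBaire_apply (p : @RadonProb X _ (borel X)) {A : Set X}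
    (hA : MeasurableSet[baireSpace X] A) :
    @ProbabilityMeasure.toMeasure X (baireSpace X) p.toBaire A =
      @RadonProb.toMeasure X _ (borel X) p A :=
  @trim_measurableSet_eq X (baireSpace X) (borel X) (@RadonProb.toMeasure X _ (borel X) p) _ baireSpace_le_borel hA

theorem RadonProb.measurable_toBaire :
    @Measurable (@RadonProb X _ (borel X)) (@ProbabilityMeasure X (baireSpace X))
      (baireSpace _) _ RadonProb.toBaire := by
  let mX : MeasurableSpace X := borel X
  have : BorelSpace X := ⟨rfl⟩
  refine @Measurable.subtype_mk _ _ (baireSpace (RadonProb X)) _ _ _ ?_ _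
  refine @Measurable.measure_of_isPiSystem_of_isProbabilityMeasure (RadonProb X) X
    (baireSpace (RadonProb X)) (baireSpace X) _ (fun p => p.toBaire.2) _
    baireSpace_eq_generateFrom isPiSystem_cozero ?_
  rintro _ ⟨h, rfl⟩
  have hA : MeasurableSet[baireSpace X] {x | h x ≠ 0} := by
    rw [baireSpace_eq_generateFrom]
    exact MeasurableSpace.measurableSet_generateFrom ⟨h, rfl⟩
  let k : ℕ → C(X, unitInterval) := fun n =>
    ⟨fun x => unitInterval.symm (unitInterval.symm (h x) ^ n), by fun_prop⟩
  have hk : ∀ n x, (k n x : ℝ) = 1 - (1 - (h x : ℝ)) ^ n := fun n x => rfl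
  let : MeasurableSpace (RadonProb X) := baireSpace (RadonProb X)
  refine ENNReal.measurable_of_tendsto
    (f := fun n (p : RadonProb X) => ENNReal.ofReal (eval (k n) p : ℝ))
    (fun n => (measurable_baire_coe (eval (k n))).ennreal_ofReal) ?_
  rw [tendsto_pi_nhds]
  intro p
  have e1 : ∀ n, ENNReal.ofReal (eval (k n) p : ℝ) =
      ∫⁻ x, ENNReal.ofReal (k n x) ∂p.toMeasure := fun n => p.ofReal_integral (k n)
  have e2 : @ProbabilityMeasure.toMeasure X (baireSpace X) p.toBaire {x | h x ≠ 0} =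
      ∫⁻ x, {x | h x ≠ 0}.indicator 1 x ∂p.toMeasure := by
    rw [p.toBaire_apply hA, lintegral_indicator_one (baireSpace_le_borel _ hA)]
  change Filter.Tendsto _ _ (𝓝 (@ProbabilityMeasure.toMeasure X (baireSpace X) p.toBaire {x | h x ≠ 0}))
  simp_rw [e1, e2]
  refine tendsto_lintegral_of_dominated_convergence (fun _ => 1)
    (fun n => (k n).continuous.subtype_val.measurable.ennreal_ofReal)
    (fun n => ae_of_all _ fun x => ENNReal.ofReal_le_one.2 (k n x).2.2) (by simp)
    (ae_of_all _ fun x => ?_)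
  simp_rw [hk]
  by_cases hx : h x = 0
  · simp [hx]
  · rw [indicator_of_mem (show x ∈ {x | h x ≠ 0} from hx)]
    have hpos : 0 < (h x : ℝ) := unitInterval.pos_iff_ne_zero.2 hx
    have ht := (tendsto_pow_atTop_nhds_zero_of_lt_one (r := 1 - (h x : ℝ))
      (by linarith [(h x).2.2]) (by linarith)).const_sub 1
    simpa [Function.comp_def] using (ENNReal.continuous_ofReal.tendsto _).comp ht

/-- The weak topology on Baire probability measures: the coarsest for which `p ↦ ∫ h dp` is
continuous for each continuous `h : X → [0,1]`. -/
abbrev baireWeakTopology (X : Type u) [TopologicalSpace X] :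
    TopologicalSpace (@ProbabilityMeasure X (baireSpace X)) :=
  letI : MeasurableSpace X := baireSpace X
  ⨅ h : C(X, unitInterval), TopologicalSpace.induced
    (fun p : ProbabilityMeasure X => ∫ x, (h x : ℝ) ∂(p : Measure X)) inferInstance

end Baire

/-- The functor assigning to a compact Hausdorff space its Baire measurable structure; it is the
identity on underlying maps. -/
def baireFunctor : CompHaus.{u} ⥤ MeasCat.{u} where
  obj X := @MeasCat.of X (baireSpace X)
  map {X Y} f := ⟨f, measurable_baire_map (X := X) (Y := Y) (ConcreteCategory.hom f)⟩

/-- The natural transformation `res : HR ⟶ GH` restricting Radon measures to the Baire sets. -/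
def radonRes : radonMonad.{u}.toFunctor ⋙ baireFunctor ⟶ baireFunctor ⋙ giryMonad.toFunctor where
  app X := ⟨RadonProb.toBaire (X := X), RadonProb.measurable_toBaire⟩
  naturality X Y f := Subtype.ext <| funext fun p : @RadonProb X _ (borel X) => Subtype.ext <| by
    let g : C(X, Y) := ConcreteCategory.hom f
    let : MeasurableSpace X := borel X
    have : BorelSpace X := ⟨rfl⟩
    let : MeasurableSpace Y := borel Y
    have : BorelSpace Y := ⟨rfl⟩
    change @ProbabilityMeasure.toMeasure Y (baireSpace Y) (p.map g).toBaire =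
      @Measure.map X Y (baireSpace X) (baireSpace Y) g
        (@ProbabilityMeasure.toMeasure X (baireSpace X) p.toBaire)
    refine @Measure.ext Y (baireSpace Y) _ _ fun A hA => ?_
    rw [RadonProb.toBaire_apply _ hA, @Measure.map_apply X Y (baireSpace X) (baireSpace Y) _ _
      (measurable_baire_map g) _ hA, RadonProb.toBaire_apply _ (measurable_baire_map g hA)]
    exact Measure.map_apply g.continuous.measurable (baireSpace_le_borel _ hA)

/-- The category `(H_* ↓ GH)` of probability endofunctors, for `H` the Baire functor and `G` the
Giry monad: its objects are pairs `(S, β)` of an endofunctor `S` of compact Hausdorff spaces and a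
natural transformation `β : HS ⟶ GH`, and a morphism `(S, β) ⟶ (S', β')` is a natural
transformation `l : S ⟶ S'` with `β' ∘ H l = β`. -/
abbrev ProbabilityEndofunctor : Type (u + 1) :=
  CostructuredArrow ((Functor.whiskeringRight CompHaus.{u} CompHaus.{u} MeasCat.{u}).obj
    baireFunctor) (baireFunctor ⋙ giryMonad.toFunctor)

/-- The unit interval as a compact Hausdorff space. -/
abbrev unitIntervalCompHaus : CompHaus.{u} := CompHaus.of (ULift.{u} unitInterval)

/-- The component of `β : HS ⟶ GH` at `[0,1]` is continuous from `S[0,1]` to the space of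
probability measures on `[0,1]` with its weak topology. -/
def ContinuousAtUnitInterval : ObjectProperty ProbabilityEndofunctor.{u} := fun S =>
  @Continuous (S.left.obj unitIntervalCompHaus) (@ProbabilityMeasure unitIntervalCompHaus (baireSpace _))
    _ (baireWeakTopology _) (S.hom.app unitIntervalCompHaus).1

end

/-! ### Baire probability measures and their Radon extensions -/

section BaireRestriction

variable {X : Type u} [TopologicalSpace X]

/-! On a compact Hausdorff space, Radon probability measures and Baire probability measures are the
same data: positive normalized functionals on the continuous functions. A Baire measure is
determined by such integrals (`baire_ext_of_integral`), and the Riesz–Markov theorem turns its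
functional into a Radon measure that restricts to it (`RadonProb.toBaire_surjective`). Hence every
component of `radonRes` is bijective.

The inverse must also be measurable into the Baire σ-algebra of the topological space of Radon
measures, which is generated by all continuous functions there and not only by the evaluations `p ↦
∫ k dp`. By Stone–Weierstrass the algebra generated by the evaluations is uniformly dense, so
measurability need only be tested on evaluations (`RadonProb.measurable_baire_of_eval`).

For terminality, bijectivity forces the mediating map at `X` to be the Radon extension of the given
Baire measure. Naturality and uniqueness follow because restriction is injective, so only continuity
is at stake. The topology on Radon measures is tested by integrals of continuous `k : X → [0,1]`,
and naturality along `k` itself rewrites such an integral as one of the identity coordinate on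
`[0,1]`. There continuity is the hypothesis (`ProbabilityEndofunctor.continuous_integral`). -/

theorem integrable_baire (μ : Measure[baireSpace X] X) [IsFiniteMeasure μ] (f : X → ℝ)
    (hm : Measurable[baireSpace X] f) (c : ℝ) (hc : ∀ x, ‖f x‖ ≤ c) : Integrable f μ :=
  Integrable.of_bound hm.aestronglyMeasurable c (ae_of_all _ hc)

/-- Finite Baire measures are determined by the integrals of continuous functions. -/
theorem baire_ext_of_integral {μ ν : Measure[baireSpace X] X} [IsProbabilityMeasure μ]
    [IsProbabilityMeasure ν]
    (h : ∀ k : C(X, unitInterval), ∫ x, (k x : ℝ) ∂μ = ∫ x, (k x : ℝ) ∂ν) : μ = ν := by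
  refine @ext_of_generate_finite X (baireSpace X) μ ν _ baireSpace_eq_generateFrom
    isPiSystem_cozero _ ?_ (by simp)
  rintro _ ⟨k, rfl⟩
  have hb : borel unitInterval = Subtype.instMeasurableSpace := BorelSpace.measurable_eq.symm
  have hk : Measurable[baireSpace X] k := hb ▸ measurable_baire k
  let mX : MeasurableSpace X := baireSpace X
  -- The cozero set of `k` is the preimage of `{0}ᶜ`, so it suffices to compare image measures on
  -- `[0,1]`, where bounded continuous functions determine a finite Borel measure.
  have hmap : μ.map k = ν.map k := by
    have := Measure.isProbabilityMeasure_map (μ := μ) hk.aemeasurable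
    have := Measure.isProbabilityMeasure_map (μ := ν) hk.aemeasurable
    refine ext_of_forall_integral_eq_of_IsFiniteMeasure fun f => ?_
    rw [integral_map hk.aemeasurable f.continuous.aestronglyMeasurable,
      integral_map hk.aemeasurable f.continuous.aestronglyMeasurable]
    -- The hypothesis covers only `[0,1]`-valued functions; an affine rescaling brings the
    -- real-valued `f` into that range.
    obtain ⟨g, a, b, hg⟩ := RadonProb.exists_affine f f.continuous
    have hint : ∀ (ρ : Measure[baireSpace X] X) [IsProbabilityMeasure ρ],
        ∫ x, f (k x) ∂ρ = a * ∫ x, (g.comp k x : ℝ) ∂ρ + b := fun ρ _ => by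
      have hi := integrable_baire ρ _ (measurable_baire_coe (g.comp k)) 1 fun x => by
        rw [Real.norm_eq_abs, abs_of_nonneg (g.comp k x).2.1]; exact (g.comp k x).2.2
      simp only [hg]
      change ∫ x, (a * (g.comp k x : ℝ) + b) ∂ρ = _
      rw [integral_add (hi.const_mul a) (integrable_const b), integral_const_mul]
      simp
    rw [hint μ, hint ν, h]
  have hs : MeasurableSet ({0}ᶜ : Set unitInterval) := (measurableSet_singleton 0).compl
  have := DFunLike.congr_fun hmap {0}ᶜ
  rwa [Measure.map_apply hk hs, Measure.map_apply hk hs] at this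

theorem RadonProb.integral_toBaire (p : @RadonProb X _ (borel X)) (k : C(X, unitInterval)) :
    ∫ x, (k x : ℝ) ∂(@ProbabilityMeasure.toMeasure X (baireSpace X) p.toBaire) =
      ∫ x, (k x : ℝ) ∂(@RadonProb.toMeasure X _ (borel X) p) :=
  (integral_trim baireSpace_le_borel (measurable_baire_coe k).stronglyMeasurable).symm

variable [CompactSpace X]

/-- Compactness bounds `f`, making it an affine image of one of the `[0,1]`-valued functions that
generate the Baire sets. -/
theorem measurable_baire_of_continuous {f : X → ℝ} (hf : Continuous f) :
    Measurable[baireSpace X] f := by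
  obtain ⟨h, a, b, rfl⟩ := RadonProb.exists_affine f hf
  exact ((measurable_baire_coe h).const_mul a).add_const b

variable [T2Space X]

/-- Integrals of continuous functions survive restriction to the Baire sets, and they determine a
Radon measure. -/
theorem RadonProb.toBaire_injective :
    Function.Injective (RadonProb.toBaire : @RadonProb X _ (borel X) → _) := by
  let mX : MeasurableSpace X := borel X
  have : BorelSpace X := ⟨rfl⟩
  intro p q hpq
  refine RadonProb.ext_of_integral fun k => ?_
  rw [← p.integral_toBaire, ← q.integral_toBaire, hpq]

/-- Every Baire probability measure on a compact Hausdorff space extends to a Radon measure. -/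
theorem RadonProb.toBaire_surjective :
    Function.Surjective (RadonProb.toBaire : @RadonProb X _ (borel X) → _) := by
  intro μ
  let ρ : Measure[baireSpace X] X := @ProbabilityMeasure.toMeasure X (baireSpace X) μ
  have hρ : IsProbabilityMeasure ρ := μ.2
  let mX : MeasurableSpace X := borel X
  have : BorelSpace X := ⟨rfl⟩
  have hint : ∀ f : X → ℝ, Continuous f → Integrable f ρ := fun f hf => by
    obtain ⟨c, hc⟩ := isCompact_univ.exists_bound_of_continuousOn hf.continuousOn
    exact integrable_baire ρ f (measurable_baire_of_continuous hf) c fun x => hc x trivial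
  -- Integration against the Baire measure is a positive functional; as `X` is compact, it is
  -- defined on all continuous functions. Its Riesz measure is the desired extension.
  let Λ : CompactlySupportedContinuousMap X ℝ →ₚ[ℝ] ℝ :=
  { toFun g := ∫ x, g x ∂ρ
    map_add' g g' := integral_add (hint g g.continuous) (hint g' g'.continuous)
    map_smul' c g := integral_smul c g
    monotone' g g' hgg' := integral_mono (hint g g.continuous) (hint g' g'.continuous) hgg' }
  have key : ∀ f : X → ℝ, Continuous f → ∫ x, f x ∂(RealRMK.rieszMeasure Λ) = ∫ x, f x ∂ρ :=
    fun f hf => RealRMK.integral_rieszMeasure Λ ⟨⟨f, hf⟩, HasCompactSupport.of_compactSpace _⟩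
  have hprob : IsProbabilityMeasure (RealRMK.rieszMeasure Λ) := by
    have := key (fun _ => 1) continuous_const
    rw [isProbabilityMeasure_iff_real]
    simpa using this
  refine ⟨⟨RealRMK.rieszMeasure Λ, hprob, inferInstance⟩, Subtype.ext ?_⟩
  refine @baire_ext_of_integral X _ _ _ (RadonProb.toBaire _).2 hρ fun k => ?_
  exact (RadonProb.integral_toBaire _ k).trans (key _ k.continuous.subtype_val)

/-- On the space of Radon measures, a map whose composites with the evaluations at continuous
functions are measurable is measurable for the Baire sets. -/
theorem RadonProb.measurable_baire_of_eval {Z : Type*} [MeasurableSpace Z]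
    (E : Z → @RadonProb X _ (borel X))
    (hE : ∀ k : C(X, unitInterval),
      Measurable fun z => ∫ x, (k x : ℝ) ∂(@RadonProb.toMeasure X _ (borel X) (E z))) :
    @Measurable Z _ _ (baireSpace (@RadonProb X _ (borel X))) E := by
  let mX : MeasurableSpace X := borel X
  have : BorelSpace X := ⟨rfl⟩
  -- Stone–Weierstrass: this algebra contains every evaluation, and evaluations separate Radon
  -- measures, so it is uniformly dense.
  let A : Subalgebra ℝ C(RadonProb X, ℝ) :=
  { carrier := {f | Measurable fun z => f (E z)}
    mul_mem' := fun hf hg => Measurable.mul hf hg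
    add_mem' := fun hf hg => Measurable.add hf hg
    algebraMap_mem' := fun r => measurable_const }
  have hsep : A.SeparatesPoints := by
    intro p q hpq
    by_contra hcon
    push Not at hcon
    refine hpq (RadonProb.ext_of_integral fun k => ?_)
    exact hcon _ ⟨⟨_, RadonProb.continuous_eval k⟩, hE k, rfl⟩
  have hmeas : ∀ f : C(RadonProb X, ℝ), Measurable fun z => f (E z) := fun f => by
    have hf := ContinuousMap.continuousMap_mem_subalgebra_closure_of_separatesPoints A hsep f
    obtain ⟨u, hu, hlim⟩ := mem_closure_iff_seq_limit.1
      (show f ∈ closure (A : Set C(RadonProb X, ℝ)) from hf)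
    -- Uniform convergence on the space of Radon measures gives pointwise convergence along `E`,
    -- which preserves measurability.
    refine measurable_of_tendsto_metrizable (f := fun n z => u n (E z)) hu
      (tendsto_pi_nhds.2 fun z => ?_)
    exact ((continuous_eval_const (F := C(RadonProb X, ℝ)) (E z)).tendsto f).comp hlim
  rw [measurable_iff_comap_le, baireSpace, MeasurableSpace.comap_iSup]
  refine iSup_le fun h => ?_
  rw [MeasurableSpace.comap_comp]
  have hb : borel unitInterval = Subtype.instMeasurableSpace := BorelSpace.measurable_eq.symm
  rw [hb]
  exact (Measurable.subtype_mk (hmeas ⟨fun p => (h p : ℝ), h.continuous.subtype_val⟩)).comap_le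

/-- The Radon extension of a Baire probability measure. -/
noncomputable def RadonProb.ofBaire (μ : @ProbabilityMeasure X (baireSpace X)) : @RadonProb X _ (borel X) :=
  (RadonProb.toBaire_surjective μ).choose

theorem RadonProb.toBaire_ofBaire (μ : @ProbabilityMeasure X (baireSpace X)) :
    (RadonProb.ofBaire μ).toBaire = μ :=
  (RadonProb.toBaire_surjective μ).choose_spec

theorem RadonProb.ofBaire_toBaire (p : @RadonProb X _ (borel X)) :
    RadonProb.ofBaire p.toBaire = p :=
  RadonProb.toBaire_injective (RadonProb.toBaire_ofBaire _)

theorem RadonProb.integral_ofBaire (μ : @ProbabilityMeasure X (baireSpace X))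
    (k : C(X, unitInterval)) :
    ∫ x, (k x : ℝ) ∂(@RadonProb.toMeasure X _ (borel X) (RadonProb.ofBaire μ)) =
      ∫ x, (k x : ℝ) ∂(@ProbabilityMeasure.toMeasure X (baireSpace X) μ) := by
  rw [← RadonProb.integral_toBaire, RadonProb.toBaire_ofBaire]

/-- Testing on evaluations leaves integrals of continuous functions against the original Baire
measure, and these are measurable for the Giry σ-algebra. -/
theorem RadonProb.measurable_ofBaire :
    @Measurable (@ProbabilityMeasure X (baireSpace X)) (@RadonProb X _ (borel X)) _
      (baireSpace _) RadonProb.ofBaire := by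
  let mX : MeasurableSpace X := baireSpace X
  refine RadonProb.measurable_baire_of_eval _ fun k => ?_
  simp_rw [RadonProb.integral_ofBaire]
  have : (fun μ : ProbabilityMeasure X => ∫ x, (k x : ℝ) ∂(μ : Measure X)) =
      fun μ : ProbabilityMeasure X => (∫⁻ x, ENNReal.ofReal (k x) ∂(μ : Measure X)).toReal :=
    funext fun μ => integral_eq_lintegral_of_nonneg_ae (ae_of_all _ fun x => (k x).2.1)
      (measurable_baire_coe k).aestronglyMeasurable
  rw [this]
  exact ((Measure.measurable_lintegral (measurable_baire_coe k).ennreal_ofReal).comp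
    measurable_giryInclusion).ennreal_toReal

end BaireRestriction

/-! ### The restriction transformation: invertibility and continuity at the unit interval -/

/-- Restriction of Radon measures to the Baire sets, as an isomorphism of measurable spaces. -/
noncomputable def radonResIso (X : CompHaus.{u}) :
    (radonMonad.toFunctor ⋙ baireFunctor).obj X ≅ (baireFunctor ⋙ giryMonad.toFunctor).obj X where
  hom := radonRes.app X
  inv := ⟨RadonProb.ofBaire (X := X), RadonProb.measurable_ofBaire⟩
  hom_inv_id := Subtype.ext <| funext fun p => RadonProb.ofBaire_toBaire (X := X) p
  inv_hom_id := Subtype.ext <| funext fun μ => RadonProb.toBaire_ofBaire (X := X) μ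

theorem isIso_radonRes : IsIso radonRes.{u} := by
  have : ∀ X, IsIso (radonRes.{u}.app X) := fun X => (radonResIso X).isIso_hom
  exact NatIso.isIso_of_isIso_app _

/-- The weak topologies on both sides are induced by integrals of the same continuous functions, and
restriction preserves those integrals. -/
theorem continuousAtUnitInterval_radonRes :
    ContinuousAtUnitInterval (CostructuredArrow.mk radonRes.{u}) := by
  refine continuous_iInf_rng.2 fun k => continuous_induced_rng.2 ?_
  refine Continuous.congr (@RadonProb.continuous_eval unitIntervalCompHaus.{u} _ (borel _) k) ?_
  exact fun p => (RadonProb.integral_toBaire p k).symm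

/-! ### Terminality of the Radon endofunctor -/

section Terminal

attribute [local instance] borelOn borelSpace_borelOn

namespace ProbabilityEndofunctor

variable (S : ProbabilityEndofunctor.{u})

/-- The Baire probability measure that a probability endofunctor attaches to a point. -/
noncomputable def toMeas (X : CompHaus.{u}) (s : S.left.obj X) : @ProbabilityMeasure X (baireSpace X) :=
  (S.hom.app X).1 s

theorem toMeas_naturality {X Y : CompHaus.{u}} (f : X ⟶ Y) (s : S.left.obj X) :
    S.toMeas Y (ConcreteCategory.hom (S.left.map f) s) =
      (giryMonad.map (baireFunctor.map f)).1 (S.toMeas X s) :=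
  congrFun (congrArg Subtype.val (S.hom.naturality f)) s

variable {S}

/-- The integral of a continuous function against a natural family of Baire measures reduces to
the component at the unit interval. -/
theorem continuous_integral (hS : ContinuousAtUnitInterval S) (X : CompHaus.{u})
    (k : C(X, unitInterval)) :
    Continuous fun s : S.left.obj X => ∫ x, (k x : ℝ) ∂(@ProbabilityMeasure.toMeasure X
      (baireSpace X) (S.toMeas X s)) := by
  -- The test function `k` becomes a morphism to the lifted interval, with `k = d ∘ g`; naturality
  -- along `g` then turns the integral of `k` into that of the coordinate `d`.
  let g : X ⟶ unitIntervalCompHaus.{u} :=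
    CompHausLike.ofHom _ ⟨fun x => ULift.up (k x), continuous_uliftUp.comp k.continuous⟩
  let d : C(unitIntervalCompHaus.{u}, unitInterval) := ⟨ULift.down, continuous_uliftDown⟩
  have hc : Continuous fun s : S.left.obj unitIntervalCompHaus.{u} =>
      ∫ x, (d x : ℝ) ∂(@ProbabilityMeasure.toMeasure unitIntervalCompHaus.{u}
        (baireSpace _) (S.toMeas unitIntervalCompHaus s)) :=
    continuous_induced_rng.1 (continuous_iInf_rng.1 hS d)
  refine (hc.comp (ConcreteCategory.hom (S.left.map g)).continuous).congr fun s => ?_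
  rw [Function.comp_apply, toMeas_naturality]
  exact integral_map (baireFunctor.map g).2.aemeasurable
    (measurable_baire_coe d).aestronglyMeasurable

/-- The map from a probability endofunctor continuous at the unit interval to the Radon
endofunctor. -/
noncomputable def toRadonMap (hS : ContinuousAtUnitInterval S) (X : CompHaus.{u}) :
    C(S.left.obj X, RadonProb X) where
  toFun s := RadonProb.ofBaire (S.toMeas X s)
  continuous_toFun := RadonProb.continuous_iff.2 fun k => by
    simp_rw [RadonProb.integral_ofBaire]
    exact continuous_integral hS X k

theorem toBaire_toRadonMap (hS : ContinuousAtUnitInterval S) (X : CompHaus.{u})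
    (s : S.left.obj X) : (toRadonMap hS X s).toBaire = S.toMeas X s :=
  RadonProb.toBaire_ofBaire _

/-- The natural transformation from a probability endofunctor continuous at the unit interval to
the Radon endofunctor. -/
noncomputable def toRadon (hS : ContinuousAtUnitInterval S) : S.left ⟶ radonMonad.{u}.toFunctor where
  app X := CompHausLike.ofHom _ (toRadonMap hS X)
  naturality X Y f := by
    -- After the injective restriction to Baire sets, the square follows from naturality of
    -- `radonRes` and of `S.hom`.
    refine ConcreteCategory.hom_ext _ _ fun s => RadonProb.toBaire_injective (X := Y) ?_
    have h := congrFun (congrArg Subtype.val (radonRes.naturality f)) (toRadonMap hS X s)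
    refine Eq.trans ?_ h.symm
    change (toRadonMap hS Y (ConcreteCategory.hom (S.left.map f) s)).toBaire =
      (giryMonad.map (baireFunctor.map f)).1 (toRadonMap hS X s).toBaire
    rw [toBaire_toRadonMap, toBaire_toRadonMap, toMeas_naturality]

theorem whisker_toRadon_comp_radonRes (hS : ContinuousAtUnitInterval S) :
    Functor.whiskerRight (toRadon hS) baireFunctor ≫ radonRes = S.hom :=
  NatTrans.ext <| funext fun X => Subtype.ext <| funext fun s => toBaire_toRadonMap hS X s

/-- The commuting triangles make both morphisms agree after `radonRes`, whose components are
injective. -/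
theorem radon_hom_ext (f g : S ⟶ CostructuredArrow.mk radonRes.{u}) : f = g := by
  refine CostructuredArrow.hom_ext _ _ (NatTrans.ext (funext fun X =>
    ConcreteCategory.hom_ext _ _ fun s => RadonProb.toBaire_injective (X := X) ?_))
  have h := (CostructuredArrow.w f).trans (CostructuredArrow.w g).symm
  exact congrFun (congrArg Subtype.val (NatTrans.congr_app h X)) s

end ProbabilityEndofunctor

end Terminal

theorem mainTheorem3 :
    IsIso radonRes.{u} ∧
      ∃ h : ContinuousAtUnitInterval (CostructuredArrow.mk radonRes.{u}),
        Nonempty (Limits.IsTerminal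
          (⟨CostructuredArrow.mk radonRes.{u}, h⟩ : ContinuousAtUnitInterval.{u}.FullSubcategory)) := by
  refine ⟨isIso_radonRes, continuousAtUnitInterval_radonRes, ⟨Limits.IsTerminal.ofUniqueHom
    (fun S => ObjectProperty.homMk (CostructuredArrow.homMk
      (ProbabilityEndofunctor.toRadon S.property)
      (ProbabilityEndofunctor.whisker_toRadon_comp_radonRes S.property))) fun S m => ?_⟩⟩
  exact ObjectProperty.hom_ext _ (ProbabilityEndofunctor.radon_hom_ext _ _)
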